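/- Let $n\ge 1$. For a Borel measure $\mu$ on $\mathbb{R}^n$ (not necessarily finite), let $$M(\mu)=\left\{\int_{\mathbb{R}^n} y f(y)\,d\mu(y)\;:\; f:\mathbb{R}^n\to[0,1]\text{ measurable},\ \int_{\mathbb{R}^n} f\,d\mu=1,\ \int_{\mathbb{R}^n}|y|f(y)\,d\mu(y)<\infty\right\}$$ be the metronoid generated by $\mu$. For a convex body $K\subseteq\mathbb{R}^n$ with gauge function $\|x\|_K=\inf\{t>0: x\in tK\}$, and $R>0$, put $$D_R^*(K)=\inf\left\{\int_{\mathbb{R}^n}\|x\|_K\,d\mu(x)\;:\;\tfrac1R M(\mu)\subseteq K\subseteq M(\mu)\right\},\qquad \mathrm{vein}^*(K)=\inf\left\{\int_{\mathbb{R}^n}\|x\|_K\,d\mu(x)\;:\;K\subseteq M(\mu)\right\},$$ where the infima are over Borel measures $\mu$ on $\mathbb{R}^n$ and are taken in $[0,\infty]$. Then for every centered convex body $K\subseteq\mathbb{R}^n$, that is, every compact convex set with non-empty interior whose center of mass is the origin, $$\mathrm{vein}^*(K)\le D_n^*(K)\le e^2 n .$$ -/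

import Mathlib

open MeasureTheory
open scoped ENNReal Pointwise

noncomputable section

/-- The metronoid `M(μ)` generated by a Borel measure `μ` on `ℝⁿ`: the set of all vectors
`∫ y f(y) dμ(y)`, over measurable `f : ℝⁿ → [0,1]` with `∫ f dμ = 1` for which this vector-valued
integral exists.  (`∫ f dμ = 1` forces `f` to be integrable.) -/
def metronoid {n : ℕ} (μ : Measure (EuclideanSpace ℝ (Fin n))) :
    Set (EuclideanSpace ℝ (Fin n)) :=
  {z | ∃ f : EuclideanSpace ℝ (Fin n) → ℝ,
    Measurable f ∧ (∀ y, 0 ≤ f y ∧ f y ≤ 1) ∧ ∫ y, f y ∂μ = 1 ∧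
    Integrable (fun y => f y • y) μ ∧ ∫ y, f y • y ∂μ = z}

/-- The cost `∫ ‖x‖_K dμ(x) ∈ [0,∞]`, where `‖·‖_K` is the gauge function of `K`. -/
def gaugeCost {n : ℕ} (K : Set (EuclideanSpace ℝ (Fin n)))
    (μ : Measure (EuclideanSpace ℝ (Fin n))) : ℝ≥0∞ :=
  ∫⁻ x, ENNReal.ofReal (gauge K x) ∂μ

/-- `D_R^*(K)`: the infimum of the costs of all Borel measures `μ` with
`(1/R) M(μ) ⊆ K ⊆ M(μ)`. -/
def DStar {n : ℕ} (R : ℝ) (K : Set (EuclideanSpace ℝ (Fin n))) : ℝ≥0∞ :=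
  ⨅ (μ : Measure (EuclideanSpace ℝ (Fin n)))
    (_ : (1 / R) • metronoid μ ⊆ K ∧ K ⊆ metronoid μ), gaugeCost K μ

/-- The fractional vertex index `vein^*(K)`: the infimum of the costs of all Borel measures `μ`
with `K ⊆ M(μ)`. -/
def fractionalVertexIndex {n : ℕ} (K : Set (EuclideanSpace ℝ (Fin n))) : ℝ≥0∞ :=
  ⨅ (μ : Measure (EuclideanSpace ℝ (Fin n))) (_ : K ⊆ metronoid μ), gaugeCost K μ

/-- A centered convex body in `ℝⁿ`: a compact convex set with non-empty interior whose center of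
mass (the average of `x` over `K` with respect to Lebesgue measure) is the origin. -/
structure IsCenteredConvexBody {n : ℕ} (K : Set (EuclideanSpace ℝ (Fin n))) : Prop where
  convex : Convex ℝ K
  isCompact : IsCompact K
  interior_nonempty : (interior K).Nonempty
  centroid_eq_zero : ⨍ x in K, x ∂volume = 0

end

open Set Filter Topology

/-! For `n ≥ 2` the witness is a multiple `c` of Lebesgue measure on `r • K`, with `r = n`. Points
of its metronoid are barycentres of probability measures on `r • K`, so the metronoid lies in `r •
K`. For `p ∈ K` and a functional `θ ≠ 0`, the cap of `r • K` where `θ ≥ θ p` contains `p + (r - 1) •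
(K ∩ {θ ≥ 0})`. By Grünbaum's inequality this has volume at least `(r - 1) ^ n * vol K / e`, so `c =
e / ((r - 1) ^ n * vol K)` gives every such cap mass at least 1. The average over the cap is then a
point of the metronoid strictly beyond `p`, and separation gives `K ⊆ M(μ)`. The cost is computed by
layer cake, and at `r = n` the bound reduces to `n ^ (n + 1) ≤ e (n + 1) (n - 1) ^ n`. For `n = 1`
the factor `r - 1` vanishes; there `K` is a symmetric segment, generated by unit masses at its
endpoints.

Grünbaum's inequality comes from Prékopa-Leindler: the tail `V` of the push-forward `ν` of the
uniform measure on `K` under `θ` is log-concave, so `log V x ≤ log V 0 + m x`. Integrating against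
the centered `ν` removes the linear term, while `∫ -log V dν ≤ 1`; hence `V 0 ≥ 1 / e`. -/

/-! ### Brunn-Minkowski on the line. -/

/-- With `p = max A` and `q = min B`, the translates `A + q` and `p + B` both lie in `C` and meet
only at `p + q`. -/
theorem Real.volume_add_le_of_isCompact {A B C : Set ℝ} (hA : IsCompact A) (hB : IsCompact B)
    (hA0 : A.Nonempty) (hB0 : B.Nonempty) (hC : A + B ⊆ C) :
    volume A + volume B ≤ volume C := by
  obtain ⟨p, hpA, hp⟩ := hA.exists_isGreatest hA0
  obtain ⟨q, hqB, hq⟩ := hB.exists_isLeast hB0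
  have h1 : volume A ≤ volume (C ∩ Iic (p + q)) := by
    rw [← measure_preimage_add_right volume (-q) A]
    refine measure_mono fun x hx => ?_
    have hx' : x + -q ∈ A := hx
    refine ⟨hC ⟨x + -q, hx', q, hqB, by ring⟩, ?_⟩
    have := hp hx'
    simp only [mem_Iic]
    linarith
  have h2 : volume B ≤ volume (C \ Iic (p + q)) := by
    have : volume B = volume (((fun x => -p + x) ⁻¹' B) \ {p + q}) := by
      rw [measure_sdiff_null (measure_singleton _), measure_preimage_add]
    rw [this]
    refine measure_mono fun x hx => ?_
    have hx' : -p + x ∈ B := hx.1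
    refine ⟨hC ⟨p, hpA, -p + x, hx', by ring⟩, ?_⟩
    have := hq hx'
    have hne : x ≠ p + q := hx.2
    simp only [mem_Iic, not_le]
    exact lt_of_le_of_ne (by linarith) hne.symm
  calc volume A + volume B ≤ volume (C ∩ Iic (p + q)) + volume (C \ Iic (p + q)) :=
        add_le_add h1 h2
    _ = volume C := measure_inter_add_sdiff C measurableSet_Iic

/-- The one-dimensional Brunn-Minkowski inequality. -/
theorem Real.volume_add_le {A B C : Set ℝ} (hA : MeasurableSet A) (hB : MeasurableSet B)
    (hA0 : A.Nonempty) (hB0 : B.Nonempty) (hC : A + B ⊆ C) :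
    volume A + volume B ≤ volume C := by
  obtain ⟨p, hp⟩ := hA0
  obtain ⟨q, hq⟩ := hB0
  have key : ∀ K, K ⊆ A → IsCompact K → ∀ L, L ⊆ B → IsCompact L →
      volume K + volume L ≤ volume C := by
    intro K hK hKc L hL hLc
    -- Inserting `p` and `q` makes the inner compact approximations nonempty.
    refine (add_le_add (measure_mono (subset_insert p K)) (measure_mono (subset_insert q L))).trans
      (Real.volume_add_le_of_isCompact (hKc.insert p) (hLc.insert q) ⟨p, by simp⟩ ⟨q, by simp⟩
        ((add_subset_add ?_ ?_).trans hC))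
    · exact insert_subset hp hK
    · exact insert_subset hq hL
  rw [hA.measure_eq_iSup_isCompact, hB.measure_eq_iSup_isCompact]
  simp_rw [iSup_and']
  exact ENNReal.biSup_add_biSup_le' ⟨∅, empty_subset _, isCompact_empty⟩
    ⟨∅, empty_subset _, isCompact_empty⟩ fun K hK L hL => key K hK.1 hK.2 L hL.1 hL.2

/-! ### The Prékopa-Leindler inequality. -/

theorem ENNReal.geom_mean_le_arith_mean2_weighted {a b : ℝ} (ha : 0 < a) (hb : 0 < b)
    (hab : a + b = 1) (x y : ℝ≥0∞) :
    x ^ a * y ^ b ≤ ENNReal.ofReal a * x + ENNReal.ofReal b * y := by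
  have ha' : ENNReal.ofReal a ≠ 0 := by simpa using ha
  have hb' : ENNReal.ofReal b ≠ 0 := by simpa using hb
  rcases eq_or_ne x ∞ with rfl | hx
  · simp [ENNReal.mul_top ha']
  rcases eq_or_ne y ∞ with rfl | hy
  · simp [ENNReal.mul_top hb']
  lift x to NNReal using hx
  lift y to NNReal using hy
  have := NNReal.geom_mean_le_arith_mean2_weighted a.toNNReal b.toNNReal x y (by
    rw [← Real.toNNReal_add ha.le hb.le, hab, Real.toNNReal_one])
  rw [Real.coe_toNNReal a ha.le, Real.coe_toNNReal b hb.le] at this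
  rw [← ENNReal.coe_rpow_of_nonneg _ ha.le, ← ENNReal.coe_rpow_of_nonneg _ hb.le]
  rw [ENNReal.ofReal, ENNReal.ofReal]
  exact_mod_cast this

theorem lintegral_eq_lintegral_Ioo_meas_lt {f : ℝ → ℝ≥0∞} (hf : Measurable f)
    (hf1 : ∀ x, f x ≤ 1) :
    ∫⁻ x, f x = ∫⁻ t in Ioo (0 : ℝ) 1, volume {x | ENNReal.ofReal t < f x} := by
  have h0 : ∀ x, f x ≠ ∞ := fun x => ((hf1 x).trans_lt ENNReal.one_lt_top).ne
  have h1 : ∫⁻ x, f x = ∫⁻ x, ENNReal.ofReal (f x).toReal := by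
    simp_rw [fun x => ENNReal.ofReal_toReal (h0 x)]
  rw [h1, lintegral_eq_lintegral_meas_lt _ (Eventually.of_forall fun x => ENNReal.toReal_nonneg)
    hf.ennreal_toReal.aemeasurable]
  have h2 : ∀ t ∈ Ioi (0 : ℝ), volume {x | t < (f x).toReal} =
      (Iio (1 : ℝ)).indicator (fun t => volume {x | ENNReal.ofReal t < f x}) t := by
    intro t ht
    by_cases ht1 : t < 1
    · rw [indicator_of_mem (by exact ht1)]
      congr 1
      ext x
      exact (ENNReal.ofReal_lt_iff_lt_toReal (le_of_lt ht) (h0 x)).symm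
    · rw [indicator_of_notMem (by exact ht1)]
      refine (congrArg volume ?_).trans (measure_empty (μ := (volume : Measure ℝ)))
      refine eq_empty_of_forall_notMem fun x hx => ht1 (lt_of_lt_of_le hx ?_)
      exact ENNReal.toReal_le_of_le_ofReal zero_le_one (by simpa using hf1 x)
  rw [setLIntegral_congr_fun measurableSet_Ioi h2, setLIntegral_indicator measurableSet_Iio,
    Iio_inter_Ioi]

theorem Real.volume_smul_set {a : ℝ} (ha : 0 < a) (s : Set ℝ) :
    volume (a • s) = ENNReal.ofReal a * volume s := by
  rw [Measure.addHaar_smul]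
  simp [abs_of_pos ha]

/-- Superlevel sets satisfy `a • {f > t} + b • {g > t} ⊆ {h > t}`, so one-dimensional
Brunn-Minkowski can be integrated over `t`. The equal suprema make both sets on the left nonempty
for every `t` in `(0, 1)`. -/
theorem lintegral_add_le_of_iSup_eq_one {a b : ℝ} (ha : 0 < a) (hb : 0 < b) (hab : a + b = 1)
    {f g h : ℝ → ℝ≥0∞} (hf : Measurable f) (hg : Measurable g) (hh : Measurable h)
    (hf1 : ⨆ x, f x = 1) (hg1 : ⨆ x, g x = 1) (hh1 : ∀ x, h x ≤ 1)
    (H : ∀ x y, f x ^ a * g y ^ b ≤ h (a * x + b * y)) :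
    ENNReal.ofReal a * (∫⁻ x, f x) + ENNReal.ofReal b * (∫⁻ x, g x) ≤ ∫⁻ x, h x := by
  have hm : ∀ f : ℝ → ℝ≥0∞, Measurable fun t : ℝ => volume {x | ENNReal.ofReal t < f x} := by
    intro f
    refine Antitone.measurable fun s t hst => measure_mono fun x hx => ?_
    exact (ENNReal.ofReal_le_ofReal hst).trans_lt hx
  have hfle : ∀ x, f x ≤ 1 := fun x => (le_iSup f x).trans_eq hf1
  have hgle : ∀ x, g x ≤ 1 := fun x => (le_iSup g x).trans_eq hg1
  rw [lintegral_eq_lintegral_Ioo_meas_lt hf hfle,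
    lintegral_eq_lintegral_Ioo_meas_lt hg hgle,
    lintegral_eq_lintegral_Ioo_meas_lt hh hh1,
    ← lintegral_const_mul _ (hm f), ← lintegral_const_mul _ (hm g),
    ← lintegral_add_left ((hm f).const_mul _)]
  refine setLIntegral_mono' measurableSet_Ioo fun t ht => ?_
  rw [← Real.volume_smul_set ha, ← Real.volume_smul_set hb]
  have ht1 : ENNReal.ofReal t < 1 := by simpa using ht.2
  have ht0 : ENNReal.ofReal t ≠ 0 := by simpa using ht.1
  have ne : ∀ {f : ℝ → ℝ≥0∞}, ⨆ x, f x = 1 → {x | ENNReal.ofReal t < f x}.Nonempty := by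
    intro f hf
    rw [← hf] at ht1
    exact lt_iSup_iff.1 ht1
  refine Real.volume_add_le
    ((measurableSet_lt measurable_const hf).const_smul₀ a)
    ((measurableSet_lt measurable_const hg).const_smul₀ b)
    (ne hf1).smul_set (ne hg1).smul_set ?_
  rintro _ ⟨_, ⟨x, hx, rfl⟩, _, ⟨y, hy, rfl⟩, rfl⟩
  refine lt_of_lt_of_le ?_ (H x y)
  calc ENNReal.ofReal t = ENNReal.ofReal t ^ a * ENNReal.ofReal t ^ b := by
        rw [← ENNReal.rpow_add _ _ ht0 ENNReal.ofReal_ne_top, hab, ENNReal.rpow_one]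
    _ < f x ^ a * g y ^ b :=
      ENNReal.mul_lt_mul (ENNReal.rpow_lt_rpow hx ha) (ENNReal.rpow_lt_rpow hy hb)

/-- The Prékopa-Leindler inequality, as a property of a measure on a real vector space. -/
def PrekopaLeindler {E : Type*} [AddCommGroup E] [Module ℝ E] [MeasurableSpace E]
    (μ : Measure E) : Prop :=
  ∀ a b : ℝ, 0 < a → 0 < b → a + b = 1 → ∀ f g h : E → ℝ≥0∞, Measurable f → Measurable g →
    Measurable h → (∀ x y, f x ^ a * g y ^ b ≤ h (a • x + b • y)) →
      (∫⁻ x, f x ∂μ) ^ a * (∫⁻ x, g x ∂μ) ^ b ≤ ∫⁻ x, h x ∂μ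

/-- Both functions are rescaled to supremum 1; the arithmetic-mean bound then implies the geometric
one, which is homogeneous and so undoes the rescaling. -/
theorem lintegral_rpow_mul_le_of_iSup_ne_top {a b : ℝ} (ha : 0 < a) (hb : 0 < b) (hab : a + b = 1)
    {f g h : ℝ → ℝ≥0∞} (hf : Measurable f) (hg : Measurable g) (hh : Measurable h)
    (hf1 : ⨆ x, f x ≠ ∞) (hg1 : ⨆ x, g x ≠ ∞)
    (H : ∀ x y, f x ^ a * g y ^ b ≤ h (a * x + b * y)) :
    (∫⁻ x, f x) ^ a * (∫⁻ x, g x) ^ b ≤ ∫⁻ x, h x := by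
  set F := ⨆ x, f x with hF
  set G := ⨆ x, g x with hG
  rcases eq_or_ne F 0 with hF0 | hF0
  · have : ∀ x, f x = 0 := fun x => le_antisymm (hF0 ▸ le_iSup f x) bot_le
    simp [this, ha]
  rcases eq_or_ne G 0 with hG0 | hG0
  · have : ∀ x, g x = 0 := fun x => le_antisymm (hG0 ▸ le_iSup g x) bot_le
    simp [this, hb]
  set c := (F⁻¹) ^ a * (G⁻¹) ^ b with hc
  have hFi0 : F⁻¹ ≠ 0 := ENNReal.inv_ne_zero.2 hf1
  have hGi0 : G⁻¹ ≠ 0 := ENNReal.inv_ne_zero.2 hg1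
  have hFi : F⁻¹ ≠ ∞ := ENNReal.inv_ne_top.2 hF0
  have hGi : G⁻¹ ≠ ∞ := ENNReal.inv_ne_top.2 hG0
  have hc0 : c ≠ 0 := by
    rw [hc]
    exact mul_ne_zero (ENNReal.rpow_pos (pos_iff_ne_zero.2 hFi0) hFi).ne'
      (ENNReal.rpow_pos (pos_iff_ne_zero.2 hGi0) hGi).ne'
  have hct : c ≠ ∞ :=
    ENNReal.mul_ne_top (ENNReal.rpow_ne_top_of_nonneg ha.le hFi)
      (ENNReal.rpow_ne_top_of_nonneg hb.le hGi)
  have hfm : ∀ x, f x * F⁻¹ ≤ 1 := fun x => by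
    rw [← ENNReal.mul_inv_cancel hF0 hf1]
    gcongr
    exact le_iSup f x
  have hgm : ∀ x, g x * G⁻¹ ≤ 1 := fun x => by
    rw [← ENNReal.mul_inv_cancel hG0 hg1]
    gcongr
    exact le_iSup g x
  have expand : ∀ u v : ℝ≥0∞, (u * F⁻¹) ^ a * (v * G⁻¹) ^ b = (u ^ a * v ^ b) * c := by
    intro u v
    rw [ENNReal.mul_rpow_of_nonneg _ _ ha.le, ENNReal.mul_rpow_of_nonneg _ _ hb.le, hc]
    ring
  have key := lintegral_add_le_of_iSup_eq_one ha hb hab (hf.mul_const F⁻¹) (hg.mul_const G⁻¹)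
    (Measurable.min (hh.mul_const c) measurable_const)
    (by rw [← ENNReal.iSup_mul, ← hF, ENNReal.mul_inv_cancel hF0 hf1])
    (by rw [← ENNReal.iSup_mul, ← hG, ENNReal.mul_inv_cancel hG0 hg1])
    (fun x => min_le_right _ 1) (by
      intro x y
      refine le_min ?_ ?_
      · rw [expand]
        gcongr
        exact H x y
      · exact mul_le_one' (ENNReal.rpow_le_one (hfm x) ha.le) (ENNReal.rpow_le_one (hgm y) hb.le))
  have := (ENNReal.geom_mean_le_arith_mean2_weighted ha hb hab (∫⁻ x, f x * F⁻¹)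
    (∫⁻ x, g x * G⁻¹)).trans (key.trans (lintegral_mono fun x => min_le_left _ _))
  rw [lintegral_mul_const _ hf, lintegral_mul_const _ hg, lintegral_mul_const _ hh, expand] at this
  exact (ENNReal.mul_le_mul_iff_left hc0 hct).1 this

theorem tendsto_lintegral_min_natCast {f : ℝ → ℝ≥0∞} (hf : Measurable f) :
    Tendsto (fun N : ℕ => ∫⁻ x, min (f x) N) atTop (𝓝 (∫⁻ x, f x)) := by
  refine lintegral_tendsto_of_tendsto_of_monotone
    (fun N => (hf.min measurable_const).aemeasurable) (Eventually.of_forall fun x N M hNM => ?_)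
    (Eventually.of_forall fun x => ?_)
  · exact min_le_min le_rfl (by exact_mod_cast hNM)
  · have := (tendsto_const_nhds (x := f x)).min ENNReal.tendsto_nat_nhds_top
    simpa using this

theorem prekopaLeindler_real : PrekopaLeindler (volume : Measure ℝ) := by
  intro a b ha hb hab f g h hf hg hh H
  rcases eq_or_ne (∫⁻ x, f x) 0 with h0 | h0
  · simp [h0, ha]
  rcases eq_or_ne (∫⁻ x, g x) 0 with h0' | h0'
  · simp [h0', hb]
  have key : ∀ N : ℕ, (∫⁻ x, min (f x) N) ^ a * (∫⁻ x, min (g x) N) ^ b ≤ ∫⁻ x, h x := by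
    intro N
    refine lintegral_rpow_mul_le_of_iSup_ne_top ha hb hab (hf.min measurable_const)
      (hg.min measurable_const) hh ?_ ?_ fun x y => le_trans ?_ (H x y)
    · exact ((iSup_le fun x => min_le_right _ _).trans_lt (ENNReal.natCast_lt_top N)).ne
    · exact ((iSup_le fun x => min_le_right _ _).trans_lt (ENNReal.natCast_lt_top N)).ne
    · gcongr <;> exact min_le_left _ _
  -- Multiplication on `ℝ≥0∞` is discontinuous at `0 * ∞`, which is why the zero integrals were
  -- split off.
  refine le_of_tendsto' (ENNReal.Tendsto.mul
    ((ENNReal.continuous_rpow_const.tendsto _).comp (tendsto_lintegral_min_natCast hf)) ?_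
    ((ENNReal.continuous_rpow_const.tendsto _).comp (tendsto_lintegral_min_natCast hg)) ?_) key
  · left
    simp [ENNReal.rpow_eq_zero_iff, h0, ha.not_gt]
  · left
    simp [ENNReal.rpow_eq_zero_iff, h0', hb.not_gt]

/-- Applying the inequality on fibres gives exactly the hypothesis needed on the base for the fibre
integrals. -/
theorem PrekopaLeindler.prod {E F : Type*} [AddCommGroup E] [Module ℝ E] [MeasurableSpace E]
    [AddCommGroup F] [Module ℝ F] [MeasurableSpace F] {μ : Measure E} {ν : Measure F}
    [SFinite ν] (hμ : PrekopaLeindler μ) (hν : PrekopaLeindler ν) :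
    PrekopaLeindler (μ.prod ν) := by
  intro a b ha hb hab f g h hf hg hh H
  rw [lintegral_prod _ hf.aemeasurable, lintegral_prod _ hg.aemeasurable,
    lintegral_prod _ hh.aemeasurable]
  refine hμ a b ha hb hab _ _ _ hf.lintegral_prod_right' hg.lintegral_prod_right'
    hh.lintegral_prod_right' fun x x' => ?_
  refine hν a b ha hb hab _ _ _ (hf.comp measurable_prodMk_left) (hg.comp measurable_prodMk_left)
    (hh.comp measurable_prodMk_left) fun y y' => ?_
  exact H (x, y) (x', y')

theorem PrekopaLeindler.of_measurePreserving {E F : Type*} [AddCommGroup E] [Module ℝ E]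
    [MeasurableSpace E] [AddCommGroup F] [Module ℝ F] [MeasurableSpace F] {μ : Measure E}
    {ν : Measure F} (hμ : PrekopaLeindler μ) {e : E → F} (he : MeasurePreserving e μ ν)
    (hlin : ∀ (a b : ℝ) x y, e (a • x + b • y) = a • e x + b • e y) : PrekopaLeindler ν := by
  intro a b ha hb hab f g h hf hg hh H
  rw [← he.lintegral_comp hf, ← he.lintegral_comp hg, ← he.lintegral_comp hh]
  refine hμ a b ha hb hab _ _ _ (hf.comp he.measurable) (hg.comp he.measurable)
    (hh.comp he.measurable) fun x y => ?_
  simpa [hlin] using H (e x) (e y)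

theorem prekopaLeindler_pi (n : ℕ) : PrekopaLeindler (volume : Measure (Fin n → ℝ)) := by
  induction n with
  | zero =>
    intro a b ha hb hab f g h hf hg hh H
    rw [volume_pi, Measure.pi_of_empty _ 0]
    simpa using H 0 0
  | succ n ih =>
    refine (prekopaLeindler_real.prod ih).of_measurePreserving
      (volume_preserving_piFinSuccAbove (fun _ => ℝ) 0).symm fun a b x y => ?_
    ext i
    refine Fin.cases ?_ (fun j => ?_) i <;> simp [MeasurableEquiv.piFinSuccAbove]

theorem prekopaLeindler_euclideanSpace (n : ℕ) :
    PrekopaLeindler (volume : Measure (EuclideanSpace ℝ (Fin n))) :=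
  (prekopaLeindler_pi n).of_measurePreserving (PiLp.volume_preserving_toLp (Fin n))
    fun a b x y => by simp

/-! ### Grünbaum's inequality. -/

/-- The tail function evaluated at a `ν`-random point stochastically dominates a uniform variable on
`[0, 1]`: a compact part of the set lies to the right of its least point `q`, whose tail is at most
`u`. Atoms are allowed. -/
theorem measure_setOf_measureReal_Ici_le (ν : Measure ℝ) [IsProbabilityMeasure ν] (u : ℝ) :
    ν {x | ν.real (Ici x) ≤ u} ≤ ENNReal.ofReal u := by
  have hanti : Antitone fun x => ν.real (Ici x) := fun x y hxy =>
    measureReal_mono (Ici_subset_Ici.2 hxy)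
  have hm : MeasurableSet {x | ν.real (Ici x) ≤ u} :=
    measurableSet_le hanti.measurable measurable_const
  rw [hm.measure_eq_iSup_isCompact]
  refine iSup_le fun C => iSup₂_le fun hC hCc => ?_
  rcases C.eq_empty_or_nonempty with rfl | hne
  · simp
  obtain ⟨q, hqC, hq⟩ := hCc.exists_isLeast hne
  have h1 : ν.real C ≤ u := (measureReal_mono fun x hx => hq hx).trans (hC hqC)
  rw [← ofReal_measureReal]
  exact ENNReal.ofReal_le_ofReal h1

theorem lintegral_neg_log_measureReal_Ici_le_one (ν : Measure ℝ) [IsProbabilityMeasure ν] :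
    ∫⁻ x, ENNReal.ofReal (-Real.log (ν.real (Ici x))) ∂ν ≤ 1 := by
  have hanti : Antitone fun x => ν.real (Ici x) := fun x y hxy =>
    measureReal_mono (Ici_subset_Ici.2 hxy)
  have h0 : ∀ x, 0 ≤ -Real.log (ν.real (Ici x)) := fun x =>
    neg_nonneg.2 (Real.log_nonpos measureReal_nonneg measureReal_le_one)
  rw [lintegral_eq_lintegral_meas_lt ν (Eventually.of_forall h0)
    (Real.measurable_log.comp hanti.measurable).neg.aemeasurable]
  calc ∫⁻ t in Ioi (0 : ℝ), ν {x | t < -Real.log (ν.real (Ici x))}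
      ≤ ∫⁻ t in Ioi (0 : ℝ), ENNReal.ofReal (Real.exp (-t)) := by
        refine setLIntegral_mono' measurableSet_Ioi fun t ht => ?_
        refine (measure_mono fun x hx => ?_).trans
          (measure_setOf_measureReal_Ici_le ν (Real.exp (-t)))
        have hx' : t < -Real.log (ν.real (Ici x)) := hx
        -- Since `Real.log 0 = 0`, points with zero tail do not enter the set for `t > 0`.
        have hpos : 0 < ν.real (Ici x) := by
          refine lt_of_le_of_ne measureReal_nonneg fun h => ?_
          rw [← h, Real.log_zero, neg_zero] at hx'
          exact lt_asymm hx' ht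
        exact (Real.log_le_iff_le_exp hpos).1 (by linarith)
    _ = 1 := by
        rw [← ofReal_integral_eq_lintegral_ofReal (integrableOn_exp_neg_Ioi 0)
          (Eventually.of_forall fun t => (Real.exp_pos _).le), integral_exp_neg_Ioi_zero,
          ENNReal.ofReal_one]

/-- A supporting line at the origin for the logarithm of a log-concave tail function. -/
theorem exists_log_le_add_mul {V : ℝ → ℝ} (hanti : Antitone V)
    (hV : ∀ a b s t : ℝ, 0 < a → 0 < b → a + b = 1 → V s ^ a * V t ^ b ≤ V (a * s + b * t))
    {s : ℝ} (hs : 0 < s) (hVs : 0 < V s) :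
    ∃ m : ℝ, ∀ x, 0 < V x → Real.log (V x) ≤ Real.log (V 0) + m * x := by
  -- Log-concavity at 0: every chord slope to the right is at most every chord slope to the left.
  -- The supremum of the right slopes serves as `m`.
  have key : ∀ x y, x < 0 → 0 < y → 0 < V y →
      (Real.log (V y) - Real.log (V 0)) / y ≤ (Real.log (V x) - Real.log (V 0)) / x := by
    intro x y hx hy hVy
    have hVx : 0 < V x := hVy.trans_le (hanti (hx.trans hy).le)
    have hyx : 0 < y - x := by linarith
    have h := hV (y / (y - x)) (-x / (y - x)) x y (div_pos hy hyx) (div_pos (by linarith) hyx)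
      (by field_simp; ring)
    rw [show y / (y - x) * x + -x / (y - x) * y = 0 by field_simp; ring] at h
    have h1 := Real.log_le_log (by positivity) h
    rw [Real.log_mul (Real.rpow_pos_of_pos hVx _).ne' (Real.rpow_pos_of_pos hVy _).ne',
      Real.log_rpow hVx, Real.log_rpow hVy, div_mul_eq_mul_div, div_mul_eq_mul_div, ← add_div,
      div_le_iff₀ hyx] at h1
    rw [div_le_iff₀ hy, div_mul_eq_mul_div, le_div_iff_of_neg hx]
    nlinarith
  set S := (fun y => (Real.log (V y) - Real.log (V 0)) / y) '' {y | 0 < y ∧ 0 < V y} with hS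
  have hne : S.Nonempty := ⟨_, s, ⟨hs, hVs⟩, rfl⟩
  have hbdd : BddAbove S := by
    refine ⟨(Real.log (V (-1)) - Real.log (V 0)) / (-1), ?_⟩
    rintro _ ⟨y, ⟨hy, hVy⟩, rfl⟩
    exact key _ _ (by norm_num) hy hVy
  refine ⟨sSup S, fun x hVx => ?_⟩
  rcases lt_trichotomy x 0 with hx | rfl | hx
  · have : sSup S ≤ (Real.log (V x) - Real.log (V 0)) / x := by
      refine csSup_le hne ?_
      rintro _ ⟨y, ⟨hy, hVy⟩, rfl⟩
      exact key _ _ hx hy hVy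
    rw [le_div_iff_of_neg hx] at this
    linarith
  · simp
  · have : (Real.log (V x) - Real.log (V 0)) / x ≤ sSup S := le_csSup hbdd ⟨x, ⟨hx, hVx⟩, rfl⟩
    rw [div_le_iff₀ hx] at this
    linarith

/-- Grünbaum's inequality for a probability measure on the line with log-concave tails. -/
theorem exp_neg_one_le_measureReal_Ici_zero (ν : Measure ℝ) [IsProbabilityMeasure ν]
    (hint : Integrable (fun x => x) ν) (hmean : ∫ x, x ∂ν = 0)
    (hV : ∀ a b s t : ℝ, 0 < a → 0 < b → a + b = 1 →
      ν.real (Ici s) ^ a * ν.real (Ici t) ^ b ≤ ν.real (Ici (a * s + b * t))) :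
    Real.exp (-1) ≤ ν.real (Ici 0) := by
  have hanti : Antitone fun x => ν.real (Ici x) := fun x y hxy =>
    measureReal_mono (Ici_subset_Ici.2 hxy)
  by_cases h : ∃ s, 0 < s ∧ 0 < ν.real (Ici s)
  · obtain ⟨s, hs, hVs⟩ := h
    have hV0 : 0 < ν.real (Ici 0) := hVs.trans_le (hanti hs.le)
    obtain ⟨m, hm⟩ := exists_log_le_add_mul (V := fun x => ν.real (Ici x)) hanti hV hs hVs
    have hpos : ∀ᵐ x ∂ν, 0 < ν.real (Ici x) := by
      rw [ae_iff]
      simpa using measure_setOf_measureReal_Ici_le ν 0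
    have hle : ∫⁻ x, ENNReal.ofReal (-Real.log (ν.real (Ici 0)) - m * x) ∂ν ≤ 1 := by
      refine le_trans (lintegral_mono_ae ?_) (lintegral_neg_log_measureReal_Ici_le_one ν)
      filter_upwards [hpos] with x hx
      exact ENNReal.ofReal_le_ofReal (by linarith [hm x hx])
    have hint' : Integrable (fun x => -Real.log (ν.real (Ici 0)) - m * x) ν :=
      (integrable_const _).sub (hint.const_mul m)
    have heq : ∫ x, (-Real.log (ν.real (Ici 0)) - m * x) ∂ν = -Real.log (ν.real (Ici 0)) := by
      rw [integral_sub (integrable_const _) (hint.const_mul m), integral_const_mul, hmean]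
      simp
    -- The negative part only lowers the integral, so the bound on the positive part suffices and
    -- integrability of `log V` is not needed.
    rw [integral_eq_lintegral_pos_part_sub_lintegral_neg_part hint'] at heq
    have h1 : -1 ≤ Real.log (ν.real (Ici 0)) := by
      have := ENNReal.toReal_mono ENNReal.one_ne_top hle
      rw [ENNReal.toReal_one] at this
      have h2 := ENNReal.toReal_nonneg
        (a := ∫⁻ x, ENNReal.ofReal (-(-Real.log (ν.real (Ici 0)) - m * x)) ∂ν)
      linarith
    exact (Real.le_log_iff_exp_le hV0).1 h1
  -- With no mass on the positive axis, mean zero forces `ν` to be concentrated at 0.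
  · push Not at h
    have hnonpos : ∀ᵐ x ∂ν, x ≤ 0 := by
      have : ∀ᵐ x ∂ν, ∀ k : ℕ, x < 1 / ((k : ℝ) + 1) := by
        refine ae_all_iff.2 fun k => ?_
        rw [ae_iff]
        have h0 := le_antisymm (h (1 / ((k : ℝ) + 1)) (by positivity)) measureReal_nonneg
        rw [measureReal_eq_zero_iff] at h0
        simpa [Ici] using h0
      filter_upwards [this] with x hx
      exact ge_of_tendsto' tendsto_one_div_add_atTop_nhds_zero_nat fun k => (hx k).le
    have hzero : ∀ᵐ x ∂ν, -x = 0 := by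
      refine (integral_eq_zero_iff_of_nonneg_ae ?_ hint.neg).1 ?_
      · filter_upwards [hnonpos] with x hx
        simpa using hx
      · exact (integral_neg _).trans (by rw [hmean, neg_zero])
    have : ν.real (Ici 0) = 1 := by
      have : ν (Ici 0) = 1 := by
        rw [prob_compl_eq_zero_iff measurableSet_Ici |>.symm]
        rw [← mem_ae_iff]
        filter_upwards [hzero] with x hx
        simp [neg_eq_zero.1 hx]
      simp [measureReal_def, this]
    rw [this]
    exact Real.exp_le_one_iff.2 (by norm_num)

/-- The multiplicative Brunn-Minkowski inequality. -/
theorem PrekopaLeindler.measure_rpow_mul_le {E : Type*} [AddCommGroup E] [Module ℝ E]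
    [MeasurableSpace E] {μ : Measure E} (hμ : PrekopaLeindler μ) {a b : ℝ} (ha : 0 < a)
    (hb : 0 < b) (hab : a + b = 1) {A B C : Set E} (hA : MeasurableSet A) (hB : MeasurableSet B)
    (hC : MeasurableSet C) (h : ∀ x ∈ A, ∀ y ∈ B, a • x + b • y ∈ C) :
    μ A ^ a * μ B ^ b ≤ μ C := by
  rw [← lintegral_indicator_one hA, ← lintegral_indicator_one hB, ← lintegral_indicator_one hC]
  refine hμ a b ha hb hab _ _ _ (measurable_one.indicator hA) (measurable_one.indicator hB)
    (measurable_one.indicator hC) fun x y => ?_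
  by_cases hx : x ∈ A
  · by_cases hy : y ∈ B
    · simp [hx, hy, h x hx y hy]
    · simp [hy, hb]
  · simp [hx, ha]

/-- **Grünbaum's inequality**: a closed half-space whose boundary contains the center of mass of a
convex body contains at least the fraction `1 / e` of its volume. -/
theorem Convex.exp_neg_one_mul_measureReal_le {n : ℕ} {K : Set (EuclideanSpace ℝ (Fin n))}
    (hK : Convex ℝ K) (hKc : IsCompact K) (hK0 : volume K ≠ 0)
    (hcen : ⨍ x in K, x ∂volume = 0) (θ : StrongDual ℝ (EuclideanSpace ℝ (Fin n))) :
    Real.exp (-1) * volume.real K ≤ volume.real (K ∩ {x | 0 ≤ θ x}) := by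
  have hKt : volume K ≠ ∞ := hKc.measure_ne_top
  have hKpos : 0 < volume.real K := ENNReal.toReal_pos hK0 hKt
  set P := (volume K)⁻¹ • (volume.restrict K) with hP
  have hPprob : IsProbabilityMeasure P := ⟨by
    simp [hP, ENNReal.inv_mul_cancel hK0 hKt]⟩
  set ν := P.map θ with hν
  have hθ : Measurable θ := θ.continuous.measurable
  have hνprob : IsProbabilityMeasure ν := Measure.isProbabilityMeasure_map hθ.aemeasurable
  have hIci : ∀ s, ν.real (Ici s) = (volume.real K)⁻¹ * volume.real (K ∩ {x | s ≤ θ x}) := by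
    intro s
    have : volume.restrict K (θ ⁻¹' Ici s) = volume (K ∩ {x | s ≤ θ x}) := by
      rw [Measure.restrict_apply (hθ measurableSet_Ici), inter_comm]
      rfl
    rw [measureReal_def, hν, Measure.map_apply hθ measurableSet_Ici, hP, Measure.smul_apply, this]
    simp [measureReal_def]
  have hid : IntegrableOn (fun x : EuclideanSpace ℝ (Fin n) => x) K volume :=
    continuous_id.continuousOn.integrableOn_compact hKc
  have hidP : Integrable (fun x => x) P := hid.smul_measure (ENNReal.inv_ne_top.2 hK0)
  have hPmean : ∫ x, x ∂P = 0 := by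
    rw [← hcen, setAverage_eq, hP, integral_smul_measure]
    simp [measureReal_def]
  have hint : Integrable (fun x => x) ν := by
    rw [hν, integrable_map_measure measurable_id'.aestronglyMeasurable hθ.aemeasurable]
    exact θ.integrable_comp hidP
  have hmean : ∫ x, x ∂ν = 0 := by
    rw [hν, integral_map hθ.aemeasurable measurable_id'.aestronglyMeasurable]
    rw [θ.integral_comp_comm hidP, hPmean, map_zero]
  have key := exp_neg_one_le_measureReal_Ici_zero ν hint hmean fun a b s t ha hb hab => by
    have hm : ∀ s, MeasurableSet (K ∩ {x | s ≤ θ x}) := fun s =>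
      hKc.measurableSet.inter (measurableSet_le measurable_const hθ)
    have h1 := (prekopaLeindler_euclideanSpace n).measure_rpow_mul_le ha hb hab (hm s) (hm t)
      (hm (a * s + b * t)) (by
        rintro x ⟨hxK, hx⟩ y ⟨hyK, hy⟩
        refine ⟨hK hxK hyK ha.le hb.le hab, ?_⟩
        simp only [mem_ofPred_eq, map_add, map_smul, smul_eq_mul] at hx hy ⊢
        gcongr)
    have hfin : volume (K ∩ {x | a * s + b * t ≤ θ x}) ≠ ∞ :=
      measure_ne_top_of_subset inter_subset_left hKt
    have h2 := ENNReal.toReal_mono hfin h1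
    rw [ENNReal.toReal_mul, ← ENNReal.toReal_rpow, ← ENNReal.toReal_rpow] at h2
    simp only [hIci]
    rw [Real.mul_rpow (by positivity) measureReal_nonneg,
      Real.mul_rpow (by positivity) measureReal_nonneg]
    calc _ = ((volume.real K)⁻¹ ^ a * (volume.real K)⁻¹ ^ b) *
          (volume.real (K ∩ {x | s ≤ θ x}) ^ a * volume.real (K ∩ {x | t ≤ θ x}) ^ b) := by ring
      _ = (volume.real K)⁻¹ *
          (volume.real (K ∩ {x | s ≤ θ x}) ^ a * volume.real (K ∩ {x | t ≤ θ x}) ^ b) := by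
        rw [← Real.rpow_add (inv_pos.2 hKpos), hab, Real.rpow_one]
      _ ≤ _ := by
        gcongr
        exact h2
  rw [hIci, ← div_eq_inv_mul, le_div_iff₀ hKpos] at key
  exact key

/-! ### Centered convex bodies and their caps. -/

section

variable {n : ℕ} {K : Set (EuclideanSpace ℝ (Fin n))}

theorem IsCenteredConvexBody.volume_ne_zero (hK : IsCenteredConvexBody K) : volume K ≠ 0 :=
  (Measure.measure_pos_of_nonempty_interior volume hK.interior_nonempty).ne'

theorem IsCenteredConvexBody.volume_ne_top (hK : IsCenteredConvexBody K) : volume K ≠ ∞ :=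
  hK.isCompact.measure_ne_top

theorem IsCenteredConvexBody.measureReal_pos (hK : IsCenteredConvexBody K) :
    0 < volume.real K :=
  ENNReal.toReal_pos hK.volume_ne_zero hK.volume_ne_top

theorem IsCenteredConvexBody.grunbaum (hK : IsCenteredConvexBody K)
    (θ : StrongDual ℝ (EuclideanSpace ℝ (Fin n))) :
    Real.exp (-1) * volume.real K ≤ volume.real (K ∩ {x | 0 ≤ θ x}) :=
  hK.convex.exp_neg_one_mul_measureReal_le hK.isCompact hK.volume_ne_zero hK.centroid_eq_zero θ

/-- Otherwise a half-space through 0 would meet `K` only in its null frontier, against Grünbaum. -/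
theorem IsCenteredConvexBody.zero_mem_interior (hK : IsCenteredConvexBody K) :
    0 ∈ interior K := by
  by_contra h0
  obtain ⟨θ, hθ⟩ := geometric_hahn_banach_open_point hK.convex.interior isOpen_interior h0
  have hsub : K ∩ {x | 0 ≤ θ x} ⊆ frontier K := fun x hx =>
    ⟨subset_closure hx.1, fun hxi => by
      have h1 := hθ x hxi
      have h2 : 0 ≤ θ x := hx.2
      rw [map_zero] at h1
      linarith⟩
  have h1 : volume.real (K ∩ {x | 0 ≤ θ x}) = 0 := by
    rw [measureReal_def, measure_mono_null hsub (hK.convex.addHaar_frontier volume)]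
    rfl
  have h2 := hK.grunbaum θ
  rw [h1] at h2
  have := mul_pos (Real.exp_pos (-1)) hK.measureReal_pos
  linarith

/-- A lower bound for the volume of the cap of `r • K` cut off by a supporting hyperplane
of `K`. -/
theorem IsCenteredConvexBody.le_measureReal_cap (hK : IsCenteredConvexBody K) {r : ℝ} (hr : 1 ≤ r)
    (θ : StrongDual ℝ (EuclideanSpace ℝ (Fin n))) {p : EuclideanSpace ℝ (Fin n)} (hp : p ∈ K) :
    (r - 1) ^ n * (Real.exp (-1) * volume.real K) ≤ volume.real (r • K ∩ {x | θ p ≤ θ x}) := by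
  have hr0 : 0 < r := by linarith
  have hsub : (fun x => -p + x) ⁻¹' ((r - 1) • (K ∩ {x | 0 ≤ θ x})) ⊆
      r • K ∩ {x | θ p ≤ θ x} := by
    rintro x ⟨k, ⟨hkK, hk⟩, hkx⟩
    have hx : x = p + (r - 1) • k := by
      have : (r - 1) • k = -p + x := hkx
      rw [this]
      abel
    constructor
    · refine ⟨(1 / r) • p + ((r - 1) / r) • k, hK.convex hp hkK (by positivity)
        (div_nonneg (by linarith) hr0.le) (by field_simp; ring), ?_⟩
      simp only [smul_add, smul_smul]
      rw [hx, mul_one_div_cancel hr0.ne', one_smul, mul_div_cancel₀ _ hr0.ne']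
    · have hk' : 0 ≤ θ k := hk
      rw [hx]
      simp only [mem_ofPred_eq, map_add, map_smul, smul_eq_mul]
      have := mul_nonneg (sub_nonneg.2 hr) hk'
      linarith
  have h1 := measureReal_mono (μ := volume) hsub (measure_ne_top_of_subset inter_subset_left
    (hK.isCompact.smul r).measure_ne_top)
  refine le_trans ?_ h1
  rw [measureReal_def (s := _ ⁻¹' _), measure_preimage_add, Measure.addHaar_smul, finrank_euclideanSpace_fin,
    abs_of_nonneg (pow_nonneg (sub_nonneg.2 hr) n), ENNReal.toReal_mul,
    ENNReal.toReal_ofReal (pow_nonneg (sub_nonneg.2 hr) n)]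
  exact mul_le_mul_of_nonneg_left (hK.grunbaum θ) (pow_nonneg (sub_nonneg.2 hr) n)

/-! ### Metronoids: inclusions by separation and by barycentres. -/

theorem convex_metronoid (μ : Measure (EuclideanSpace ℝ (Fin n))) : Convex ℝ (metronoid μ) := by
  rintro _ ⟨f, hf, hf01, hf1, hfi, rfl⟩ _ ⟨g, hg, hg01, hg1, hgi, rfl⟩ a b ha hb hab
  have hfint : Integrable f μ := by
    by_contra h
    simp [integral_undef h] at hf1
  have hgint : Integrable g μ := by
    by_contra h
    simp [integral_undef h] at hg1
  have heq : (fun y => (a * f y + b * g y) • y) = fun y => a • (f y • y) + b • (g y • y) := by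
    ext1 y
    rw [add_smul, mul_smul, mul_smul]
  refine ⟨fun y => a * f y + b * g y, (hf.const_mul a).add (hg.const_mul b), fun y => ⟨?_, ?_⟩,
    ?_, ?_, ?_⟩
  · exact add_nonneg (mul_nonneg ha (hf01 y).1) (mul_nonneg hb (hg01 y).1)
  · calc a * f y + b * g y ≤ a * 1 + b * 1 :=
          add_le_add (mul_le_mul_of_nonneg_left (hf01 y).2 ha)
            (mul_le_mul_of_nonneg_left (hg01 y).2 hb)
      _ = 1 := by rw [mul_one, mul_one, hab]
  · rw [integral_add (hfint.const_mul a) (hgint.const_mul b), integral_const_mul,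
      integral_const_mul, hf1, hg1, mul_one, mul_one, hab]
  · rw [heq]
    exact (hfi.smul a).add (hgi.smul b)
  · rw [heq]
    refine (integral_add (hfi.smul a) (hgi.smul b)).trans ?_
    simp only [Pi.smul_apply, integral_smul]

/-- A convex set in a finite-dimensional space which strictly reaches beyond every hyperplane
through a point of a set containing the origin contains that set. -/
theorem Convex.subset_of_forall_exists_lt {E : Type*} [NormedAddCommGroup E] [NormedSpace ℝ E]
    [FiniteDimensional ℝ E] {K M : Set E} (hM : Convex ℝ M) (hMne : M.Nonempty)
    (h0 : (0 : E) ∈ K)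
    (H : ∀ θ : StrongDual ℝ E, θ ≠ 0 → ∀ z ∈ K, ∃ m ∈ M, θ z < θ m) : K ⊆ M := by
  have hint : (interior M).Nonempty := by
    rw [hM.interior_nonempty_iff_affineSpan_eq_top]
    by_contra htop
    have hdir : (affineSpan ℝ M).direction ≠ ⊤ := fun h =>
      htop ((AffineSubspace.direction_eq_top_iff_of_nonempty
        (hMne.mono (subset_affineSpan ℝ M))).1 h)
    obtain ⟨f, hf0, hf⟩ := Submodule.exists_le_ker_of_lt_top _ (lt_top_iff_ne_top.2 hdir)
    set θ : StrongDual ℝ E := LinearMap.toContinuousLinearMap f with hθ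
    have hθ0 : θ ≠ 0 := fun h => hf0 (LinearMap.toContinuousLinearMap.map_eq_zero_iff.1 h)
    -- Using `θ` and `-θ` at the origin shows that `M` lies in no hyperplane, hence has interior.
    obtain ⟨m, hm, h1⟩ := H θ hθ0 0 h0
    obtain ⟨m', hm', h2⟩ := H (-θ) (neg_ne_zero.2 hθ0) 0 h0
    have h3 : f (m - m') = 0 := hf (AffineSubspace.vsub_mem_direction
      (subset_affineSpan ℝ M hm) (subset_affineSpan ℝ M hm'))
    have h4 : θ m - θ m' = 0 := by rw [← map_sub]; exact h3
    simp only [map_zero, neg_apply] at h1 h2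
    linarith
  intro z hz
  by_contra hzM
  obtain ⟨θ, hθ0, hθ⟩ := geometric_hahn_banach_of_nonempty_interior_point hM
    (fun h => hzM (interior_subset h)) hint
  obtain ⟨m, hm, hlt⟩ := H θ hθ0 z hz
  exact (hθ m hm).not_gt hlt

theorem volume_setOf_strongDual_eq {θ : StrongDual ℝ (EuclideanSpace ℝ (Fin n))} (hθ : θ ≠ 0)
    (p : EuclideanSpace ℝ (Fin n)) : volume {x | θ x = θ p} = 0 := by
  have h := Measure.addHaar_affineSubspace volume
    (AffineSubspace.mk' p (LinearMap.ker (θ : EuclideanSpace ℝ (Fin n) →ₗ[ℝ] ℝ))) (by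
      intro h
      have h1 := congrArg AffineSubspace.direction h
      rw [AffineSubspace.direction_mk', AffineSubspace.direction_top, LinearMap.ker_eq_top] at h1
      exact hθ (ContinuousLinearMap.coe_injective h1))
  convert h using 2
  ext x
  simp [AffineSubspace.mem_mk', sub_eq_zero]

/-- Averages over caps of measure at least one belong to the metronoid. -/
theorem exists_mem_metronoid_lt (hK : IsCompact K) {c : ℝ} (hc : 0 < c)
    {θ : StrongDual ℝ (EuclideanSpace ℝ (Fin n))} (hθ : θ ≠ 0) {p : EuclideanSpace ℝ (Fin n)}
    (hcap : 1 ≤ c * volume.real (K ∩ {x | θ p ≤ θ x})) :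
    ∃ m ∈ metronoid (ENNReal.ofReal c • volume.restrict K), θ p < θ m := by
  set C := K ∩ {x | θ p ≤ θ x} with hC
  set μ : Measure (EuclideanSpace ℝ (Fin n)) := ENNReal.ofReal c • volume.restrict K with hμ
  set w := c * volume.real C with hw
  have hw0 : 0 < w := by linarith
  have hCm : MeasurableSet C :=
    hK.measurableSet.inter (measurableSet_le measurable_const θ.continuous.measurable)
  have hCc : IsCompact C :=
    hK.inter_right (isClosed_le continuous_const θ.continuous)
  have hμC : μ.restrict C = ENNReal.ofReal c • volume.restrict C := by
    rw [hμ, Measure.restrict_smul, Measure.restrict_restrict hCm,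
      inter_eq_self_of_subset_left inter_subset_left]
  have hid : IntegrableOn (fun x : EuclideanSpace ℝ (Fin n) => x) C volume :=
    continuous_id.continuousOn.integrableOn_compact hCc
  have hidμ : IntegrableOn (fun x : EuclideanSpace ℝ (Fin n) => x) C μ := by
    rw [IntegrableOn, hμC]
    exact Integrable.smul_measure hid ENNReal.ofReal_ne_top
  have heq : (fun y => (C.indicator (fun _ => w⁻¹) y : ℝ) • y) =
      C.indicator fun y => w⁻¹ • y := by
    ext1 y
    by_cases hy : y ∈ C <;> simp [hy]
  -- The barycentre of the cap; `w ≥ 1` keeps the density `w⁻¹` at most 1.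
  refine ⟨∫ y, (C.indicator (fun _ => w⁻¹) y : ℝ) • y ∂μ, ⟨C.indicator fun _ => w⁻¹,
    measurable_const.indicator hCm, fun y => ⟨?_, ?_⟩, ?_, ?_, rfl⟩, ?_⟩
  · exact indicator_nonneg (fun _ _ => by positivity) y
  · exact indicator_le_self' (fun _ _ => zero_le_one) y |>.trans' (indicator_le_indicator
      (inv_le_one_of_one_le₀ hcap))
  · rw [integral_indicator hCm, hμC, integral_smul_measure, setIntegral_const,
      ENNReal.toReal_ofReal hc.le, smul_eq_mul, smul_eq_mul, ← mul_assoc, mul_inv_cancel₀ hw0.ne']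
  · rw [heq, integrable_indicator_iff hCm]
    exact hidμ.smul w⁻¹
  · rw [heq, integral_indicator hCm, integral_smul, map_smul, hμC, integral_smul_measure,
      map_smul, ENNReal.toReal_ofReal hc.le, ← θ.integral_comp_comm hid, smul_eq_mul, smul_eq_mul,
      ← div_eq_inv_mul, lt_div_iff₀ hw0]
    have hθint : IntegrableOn (fun x => θ x) C volume := θ.integrable_comp hid
    -- Strictness: the bounding hyperplane is null, whereas the cap has positive volume.
    have hpos : 0 < ∫ x in C, (θ x - θ p) := by
      rw [setIntegral_pos_iff_support_of_nonneg_ae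
        ((ae_restrict_mem hCm).mono fun x hx => sub_nonneg.2 hx.2)
        (hθint.sub (integrableOn_const hCc.measure_ne_top))]
      have h1 : (Function.support fun x => θ x - θ p) ∩ C = C \ {x | θ x = θ p} := by
        ext x
        simp [sub_eq_zero, and_comm]
      rw [h1, measure_sdiff_null (volume_setOf_strongDual_eq hθ p)]
      refine pos_iff_ne_zero.2 fun h => ?_
      rw [hw, measureReal_def, h] at hw0
      simp at hw0
    rw [integral_sub hθint (integrableOn_const hCc.measure_ne_top), setIntegral_const,
      smul_eq_mul] at hpos
    rw [hw]
    nlinarith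

/-- The measure `f dμ` is a probability measure carried by `K`, and its barycentre stays in a closed
convex set. -/
theorem metronoid_subset (hK : Convex ℝ K) (hKc : IsClosed K)
    {μ : Measure (EuclideanSpace ℝ (Fin n))} (hμ : ∀ᵐ x ∂μ, x ∈ K) : metronoid μ ⊆ K := by
  rintro _ ⟨f, hf, hf01, hf1, hfi, rfl⟩
  have hfint : Integrable f μ := by
    by_contra h
    simp [integral_undef h] at hf1
  set P := μ.withDensity fun y => ((f y).toNNReal : ℝ≥0∞) with hP
  have hfm : Measurable fun y => (f y).toNNReal := hf.real_toNNReal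
  have hsm : ∀ y : EuclideanSpace ℝ (Fin n), (f y).toNNReal • y = f y • y := fun y => by
    rw [NNReal.smul_def, Real.coe_toNNReal _ (hf01 y).1]
  have hprob : IsProbabilityMeasure P := ⟨by
    rw [hP, withDensity_apply _ MeasurableSet.univ, setLIntegral_univ]
    have := ofReal_integral_eq_lintegral_ofReal hfint (Eventually.of_forall fun y => (hf01 y).1)
    rw [hf1, ENNReal.ofReal_one] at this
    exact this.symm⟩
  have h1 : ∫ y, y ∂P = ∫ y, f y • y ∂μ := by
    rw [hP, integral_withDensity_eq_integral_smul hfm]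
    simp_rw [hsm]
  rw [← h1]
  refine hK.integral_mem hKc ((withDensity_absolutelyContinuous _ _).ae_le hμ) ?_
  rw [hP, integrable_withDensity_iff_integrable_smul hfm]
  simpa only [hsm] using hfi

/-! ### The cost of the uniform measure. -/

/-- Layer cake: `{gauge K > t}` cuts `r • K` down to `r • K \ t • K`, of volume `(r ^ n - t ^ n) *
vol K` for `t < r`. -/
theorem IsCenteredConvexBody.setLIntegral_gauge (hK : IsCenteredConvexBody K) {r : ℝ}
    (hr : 0 < r) : ∫⁻ x in r • K, ENNReal.ofReal (gauge K x) =
      ENNReal.ofReal (r ^ (n + 1) * (n / (n + 1)) * volume.real K) := by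
  have h0 : K ∈ 𝓝 0 := mem_interior_iff_mem_nhds.1 hK.zero_mem_interior
  have hcont : Continuous (gauge K) := continuous_gauge hK.convex h0
  have hmem : ∀ t : ℝ, 0 < t → ∀ x, gauge K x ≤ t ↔ x ∈ t • K := by
    intro t ht x
    rw [mem_smul_set_iff_inv_smul_mem₀ ht.ne', ← hK.isCompact.isClosed.closure_eq,
      ← gauge_le_one_iff_mem_closure hK.convex h0, hK.isCompact.isClosed.closure_eq,
      gauge_smul_of_nonneg (inv_nonneg.2 ht.le), smul_eq_mul, inv_mul_le_iff₀ ht, mul_one]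
  have hvol : ∀ t : ℝ, 0 < t → volume (t • K) = ENNReal.ofReal (t ^ n * volume.real K) := by
    intro t ht
    rw [Measure.addHaar_smul, finrank_euclideanSpace_fin, abs_of_nonneg (by positivity),
      ENNReal.ofReal_mul (by positivity), ofReal_measureReal hK.volume_ne_top]
  rw [lintegral_eq_lintegral_meas_lt _ (Eventually.of_forall gauge_nonneg)
    hcont.measurable.aemeasurable]
  have hlevel : ∀ t ∈ Ioi (0 : ℝ), volume.restrict (r • K) {x | t < gauge K x} =
      (Iio r).indicator (fun t => ENNReal.ofReal ((r ^ n - t ^ n) * volume.real K)) t := by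
    intro t ht
    rw [Measure.restrict_apply (measurableSet_lt measurable_const hcont.measurable)]
    have hset : {x | t < gauge K x} ∩ r • K = r • K \ t • K := by
      ext x
      rw [mem_inter_iff, Set.mem_sdiff, ← hmem t ht x, not_le, and_comm]
      rfl
    rw [hset]
    by_cases htr : t < r
    · rw [indicator_of_mem (by exact htr), measure_sdiff, hvol r hr, hvol t ht, sub_mul,
        ENNReal.ofReal_sub _ (mul_nonneg (pow_nonneg (le_of_lt ht) n) measureReal_nonneg)]
      · intro x hx
        rw [← hmem r hr]
        exact ((hmem t ht x).2 hx).trans htr.le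
      · exact (hK.isCompact.smul t).measurableSet.nullMeasurableSet
      · exact (hK.isCompact.smul t).measure_ne_top
    · rw [indicator_of_notMem (by exact htr)]
      refine (congrArg volume ?_).trans (measure_empty (μ := volume))
      rw [sdiff_eq_empty]
      intro x hx
      rw [← hmem t ht]
      exact ((hmem r hr x).2 hx).trans (not_lt.1 htr)
  have hci : Continuous fun t : ℝ => (r ^ n - t ^ n) * volume.real K := by fun_prop
  rw [setLIntegral_congr_fun measurableSet_Ioi hlevel, setLIntegral_indicator measurableSet_Iio,
    Iio_inter_Ioi, restrict_Ioo_eq_restrict_Ioc, ← ofReal_integral_eq_lintegral_ofReal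
      (hci.integrableOn_Ioc) ?_, ← intervalIntegral.integral_of_le hr.le]
  · congr 1
    rw [intervalIntegral.integral_mul_const, intervalIntegral.integral_sub 
      intervalIntegrable_const ((continuous_pow n).intervalIntegrable 0 r), integral_pow, intervalIntegral.integral_const]
    simp only [smul_eq_mul]
    field_simp
    ring
  · filter_upwards [ae_restrict_mem measurableSet_Ioc] with t ht
    exact mul_nonneg (sub_nonneg.2 (pow_le_pow_left₀ ht.1.le ht.2 n)) measureReal_nonneg

/-- The uniform measure on `r • K` of large enough total mass generates a metronoid containing
`K` and contained in `r • K`. -/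
theorem IsCenteredConvexBody.DStar_le (hK : IsCenteredConvexBody K) (hn : n ≠ 0) {r : ℝ}
    (hr : 1 < r) :
    DStar r K ≤ ENNReal.ofReal (Real.exp 1 * r ^ (n + 1) * n / ((n + 1) * (r - 1) ^ n)) := by
  have hr0 : 0 < r := by linarith
  have hr1 : 0 < (r - 1) ^ n := pow_pos (by linarith) n
  have hV := hK.measureReal_pos
  -- Chosen so that the lower bound for the mass of a cap is exactly 1.
  set c := Real.exp 1 / ((r - 1) ^ n * volume.real K) with hc
  have hc0 : 0 < c := by positivity
  have hcost : gaugeCost K (ENNReal.ofReal c • volume.restrict (r • K)) =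
      ENNReal.ofReal (Real.exp 1 * r ^ (n + 1) * n / ((n + 1) * (r - 1) ^ n)) := by
    rw [gaugeCost, lintegral_smul_measure, hK.setLIntegral_gauge hr0, smul_eq_mul,
      ← ENNReal.ofReal_mul hc0.le, hc]
    congr 1
    field_simp
  rw [← hcost]
  refine iInf₂_le _ ⟨?_, ?_⟩
  · have hsub : metronoid (ENNReal.ofReal c • volume.restrict (r • K)) ⊆ r • K :=
      metronoid_subset (hK.convex.smul r) (hK.isCompact.smul r).isClosed
        (Measure.ae_smul_measure (ae_restrict_mem (hK.isCompact.smul r).measurableSet) _)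
    rintro _ ⟨z, hz, rfl⟩
    obtain ⟨k, hk, rfl⟩ := hsub hz
    simpa [smul_smul, hr0.ne'] using hk
  · have h0 : (0 : EuclideanSpace ℝ (Fin n)) ∈ K := interior_subset hK.zero_mem_interior
    have H : ∀ θ : StrongDual ℝ (EuclideanSpace ℝ (Fin n)), θ ≠ 0 → ∀ z ∈ K,
        ∃ m ∈ metronoid (ENNReal.ofReal c • volume.restrict (r • K)), θ z < θ m := by
      intro θ hθ z hz
      refine exists_mem_metronoid_lt (hK.isCompact.smul r) hc0 hθ ?_
      have h1 := mul_le_mul_of_nonneg_left (hK.le_measureReal_cap hr.le θ hz) hc0.le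
      refine le_of_eq_of_le ?_ h1
      rw [hc, Real.exp_neg]
      field_simp
    refine (convex_metronoid _).subset_of_forall_exists_lt ?_ h0 H
    obtain ⟨m, hm, -⟩ := H (EuclideanSpace.proj (⟨0, Nat.pos_of_ne_zero hn⟩ : Fin n)) (by
      intro h
      have := congrArg (fun θ : StrongDual ℝ (EuclideanSpace ℝ (Fin n)) =>
        θ (EuclideanSpace.single ⟨0, Nat.pos_of_ne_zero hn⟩ 1)) h
      simp at this) 0 h0
    exact ⟨m, hm⟩

/-- After taking logarithms the claim is `n log (n / (n - 1)) ≤ 1 + log (1 + 1 / n)`. The left side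
is bounded by `log x ≤ sinh (log x) = (x - 1 / x) / 2`, the right by `2 x / (x + 2) ≤ log (1 + x)`.
The resulting rational inequality `h5` needs `n ≥ 5 / 2`, so `n = 2` is checked numerically. -/
theorem pow_succ_le_exp_one_mul {n : ℕ} (hn : 2 ≤ n) :
    (n : ℝ) ^ (n + 1) ≤ Real.exp 1 * (n + 1) * ((n : ℝ) - 1) ^ n := by
  rcases hn.eq_or_lt with rfl | hn
  · have := Real.exp_one_gt_d9
    norm_num
    linarith
  have hn' : (3 : ℝ) ≤ n := by exact_mod_cast hn
  have h1 : 0 < (n : ℝ) - 1 := by linarith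
  have h2 : n * Real.log (n / (n - 1)) ≤ (2 * n - 1) / (2 * (n - 1)) := by
    have h3 := Real.self_le_sinh_iff.2 (Real.log_nonneg ((one_le_div h1).2 (by linarith)))
    rw [Real.sinh_log (by positivity)] at h3
    refine (mul_le_mul_of_nonneg_left h3 (by linarith)).trans_eq ?_
    field_simp
    ring
  have h4 : 2 / (2 * n + 1) ≤ Real.log (1 + 1 / n) := by
    refine le_of_eq_of_le ?_ (Real.le_log_one_add_of_nonneg (x := 1 / n) (by positivity))
    field_simp
    ring
  have h5 : ((2 : ℝ) * n - 1) / (2 * (n - 1)) ≤ 1 + 2 / (2 * n + 1) := by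
    rw [div_le_iff₀ (by linarith), one_add_div (by positivity), div_mul_eq_mul_div,
      le_div_iff₀ (by positivity)]
    nlinarith
  rw [show (1 : ℝ) + 1 / n = (n + 1) / n by field_simp,
    Real.log_div (by positivity) (by positivity)] at h4
  rw [Real.log_div (by positivity) h1.ne'] at h2
  rw [← Real.log_le_log_iff (by positivity) (by positivity), Real.log_mul (by positivity)
    (by positivity), Real.log_mul (by positivity) (by positivity), Real.log_exp, Real.log_pow,
    Real.log_pow]
  push_cast
  linarith

/-! ### Dimension one. -/

theorem IsCenteredConvexBody.exists_eq_image_Icc {K : Set (EuclideanSpace ℝ (Fin 1))}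
    (hK : IsCenteredConvexBody K) :
    ∃ p : EuclideanSpace ℝ (Fin 1), p ≠ 0 ∧ K = (fun t : ℝ => t • p) '' Icc (-1) 1 := by
  set φ : ℝ ≃ᵐ EuclideanSpace ℝ (Fin 1) :=
    (MeasurableEquiv.funUnique (Fin 1) ℝ).symm.trans (MeasurableEquiv.toLp 2 (Fin 1 → ℝ))
  have hφ : MeasurePreserving φ := (PiLp.volume_preserving_toLp (Fin 1)).comp
    (volume_preserving_funUnique (Fin 1) ℝ).symm
  have hφ0 : ∀ t, φ t 0 = t := fun t => rfl
  have hφs : ∀ x : EuclideanSpace ℝ (Fin 1), φ (x 0) = x := fun x => by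
    ext i
    rw [Subsingleton.elim i 0, hφ0]
  set π : StrongDual ℝ (EuclideanSpace ℝ (Fin 1)) := EuclideanSpace.proj 0
  have hpre : φ ⁻¹' K = π '' K := by
    ext t
    exact ⟨fun ht => ⟨φ t, ht, rfl⟩, by rintro ⟨x, hx, rfl⟩; exact (hφs x).symm ▸ hx⟩
  have hne : K.Nonempty := hK.interior_nonempty.mono interior_subset
  obtain ⟨a, b, hI⟩ : ∃ a b : ℝ, φ ⁻¹' K = Icc a b := by
    rw [hpre]
    exact ⟨_, _, eq_Icc_of_connected_compact
      ((hK.convex.isConnected hne).image π π.continuous.continuousOn)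
      (hK.isCompact.image π.continuous)⟩
  have hvol : volume (Icc a b) ≠ 0 := by
    rw [← hI, hφ.measure_preimage hK.isCompact.measurableSet.nullMeasurableSet]
    exact hK.volume_ne_zero
  have hab : a < b := by simpa using hvol
  have hint : ∫ x in K, x = 0 := by
    have h := hK.centroid_eq_zero
    rw [setAverage_eq] at h
    exact (smul_eq_zero.1 h).resolve_left (inv_ne_zero hK.measureReal_pos.ne')
  have hid : IntegrableOn (fun x : EuclideanSpace ℝ (Fin 1) => x) K volume :=
    continuous_id.continuousOn.integrableOn_compact hK.isCompact
  have hint' : ∫ t in Icc a b, t = 0 := by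
    have h := π.integral_comp_comm hid
    rw [hint, map_zero, ← hφ.setIntegral_preimage_emb φ.measurableEmbedding, hI] at h
    exact h
  rw [integral_Icc_eq_integral_Ioc, ← intervalIntegral.integral_of_le hab.le, integral_id] at hint'
  have ha : a = -b := by
    have : (b - a) * (b + a) = 0 := by linarith
    rcases mul_eq_zero.1 this with h | h <;> linarith
  subst ha
  have hb : 0 < b := by linarith
  have hsmul : ∀ t : ℝ, t • φ b = φ (t * b) := fun t => by
    ext i
    rw [Subsingleton.elim i 0]
    rfl
  refine ⟨φ b, fun h => hb.ne' ?_, ?_⟩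
  · rw [← hφ0 b, h]
    rfl
  · ext x
    have hx : x ∈ K ↔ x 0 ∈ Icc (-b) b := by
      rw [← hI, mem_preimage, hφs]
    rw [hx]
    constructor
    · intro h
      refine ⟨x 0 / b, ⟨?_, ?_⟩, ?_⟩
      · rw [le_div_iff₀ hb]
        linarith [h.1]
      · rw [div_le_iff₀ hb]
        linarith [h.2]
      · exact (hsmul _).trans (by rw [div_mul_cancel₀ _ hb.ne', hφs])
    · rintro ⟨t, ht, rfl⟩
      simp only [hsmul, hφ0]
      constructor <;> nlinarith [ht.1, ht.2]

theorem metronoid_dirac_add_dirac_neg {p : EuclideanSpace ℝ (Fin n)} (hp : p ≠ 0) :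
    metronoid (Measure.dirac p + Measure.dirac (-p)) = (fun t : ℝ => t • p) '' Icc (-1) 1 := by
  have hint : ∀ (F : Type) [NormedAddCommGroup F] [NormedSpace ℝ F] [CompleteSpace F]
      (f : EuclideanSpace ℝ (Fin n) → F),
      Integrable f (Measure.dirac p + Measure.dirac (-p)) ∧
      ∫ y, f y ∂(Measure.dirac p + Measure.dirac (-p)) = f p + f (-p) := by
    intro F _ _ _ f
    have h1 : Integrable f (Measure.dirac p) := integrable_dirac (by simp)
    have h2 : Integrable f (Measure.dirac (-p)) := integrable_dirac (by simp)
    exact ⟨h1.add_measure h2, by rw [integral_add_measure h1 h2, integral_dirac, integral_dirac]⟩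
  have hpn : -p ≠ p := fun h => hp (by
    have h2 : (2 : ℝ) • p = 0 := by rw [two_smul]; nth_rewrite 1 [← h]; exact neg_add_cancel p
    exact (smul_eq_zero.1 h2).resolve_left two_ne_zero)
  ext z
  constructor
  · rintro ⟨f, hf, hf01, hf1, hfi, rfl⟩
    rw [(hint _ f).2] at hf1
    rw [(hint _ _).2]
    refine ⟨f p - f (-p), ⟨?_, ?_⟩, ?_⟩
    · linarith [(hf01 p).1, (hf01 (-p)).2]
    · linarith [(hf01 (-p)).1, (hf01 p).2]
    · simp only [sub_smul, smul_neg]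
      abel
  · rintro ⟨t, ht, rfl⟩
    classical
    refine ⟨fun y => if y = p then (1 + t) / 2 else (1 - t) / 2,
      Measurable.ite (measurableSet_singleton p) measurable_const measurable_const, fun y => ?_, ?_,
      (hint _ _).1, ?_⟩
    · dsimp only
      split_ifs <;> constructor <;> linarith [ht.1, ht.2]
    · rw [(hint _ _).2, if_pos rfl, if_neg hpn]
      ring
    · rw [(hint _ _).2]
      dsimp only
      rw [if_pos rfl, if_neg hpn, smul_neg, ← sub_eq_add_neg, ← sub_smul]
      congr 1
      ring

theorem IsCenteredConvexBody.DStar_one_le {K : Set (EuclideanSpace ℝ (Fin 1))}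
    (hK : IsCenteredConvexBody K) : DStar 1 K ≤ 2 := by
  obtain ⟨p, hp, hKp⟩ := hK.exists_eq_image_Icc
  have hM : metronoid (Measure.dirac p + Measure.dirac (-p)) = K := by
    rw [metronoid_dirac_add_dirac_neg hp, hKp]
  have hpK : p ∈ K := hKp ▸ ⟨1, by simp, one_smul ℝ p⟩
  have hpK' : -p ∈ K := hKp ▸ ⟨-1, by simp, neg_one_smul ℝ p⟩
  have hsub : (1 / (1 : ℝ)) • metronoid (Measure.dirac p + Measure.dirac (-p)) ⊆ K := by
    rw [hM, one_div, inv_one, one_smul]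
  calc DStar 1 K ≤ gaugeCost K (Measure.dirac p + Measure.dirac (-p)) :=
        iInf₂_le _ ⟨hsub, hM.ge⟩
    _ = ENNReal.ofReal (gauge K p) + ENNReal.ofReal (gauge K (-p)) := by
        rw [gaugeCost, lintegral_add_measure, lintegral_dirac, lintegral_dirac]
    _ ≤ 1 + 1 := add_le_add (ENNReal.ofReal_le_one.2 (gauge_le_one_of_mem hpK))
        (ENNReal.ofReal_le_one.2 (gauge_le_one_of_mem hpK'))
    _ = 2 := one_add_one_eq_two

end

/-! ### Conclusion. -/

theorem corollary1p3 (n : ℕ) (hn : 1 ≤ n) (K : Set (EuclideanSpace ℝ (Fin n)))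
    (hK : IsCenteredConvexBody K) :
    fractionalVertexIndex K ≤ DStar (n : ℝ) K ∧
      DStar (n : ℝ) K ≤ ENNReal.ofReal (Real.exp 2 * (n : ℝ)) := by
  refine ⟨iInf_mono fun μ => iInf_mono' fun h => ⟨h.2, le_rfl⟩, ?_⟩
  rcases hn.eq_or_lt with rfl | hn
  · rw [Nat.cast_one, mul_one]
    refine hK.DStar_one_le.trans ?_
    -- The cost 2 of the two endpoint masses is below `e ^ 2`.
    rw [← ENNReal.ofReal_ofNat 2]
    exact ENNReal.ofReal_le_ofReal (by linarith [Real.add_one_le_exp 2])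
  · have hn' : (2 : ℝ) ≤ n := by exact_mod_cast hn
    refine (hK.DStar_le (by lia) (by linarith)).trans (ENNReal.ofReal_le_ofReal ?_)
    have hpos : 0 < ((n : ℝ) - 1) ^ n := pow_pos (by linarith) n
    rw [div_le_iff₀ (by positivity), show (2 : ℝ) = 1 + 1 by norm_num, Real.exp_add]
    have := mul_le_mul_of_nonneg_left (pow_succ_le_exp_one_mul hn)
      (by positivity : 0 ≤ Real.exp 1 * n)
    linarith
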